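/- Let $X$ be a separable infinite-dimensional complex Banach space, let $N \colon X \to X$ be a nilpotent bounded linear operator (that is, $N^k = 0$ for some $k \ge 1$), and let $\lambda \in \mathbb{C}$ with $|\lambda| = 1$. Then $\lambda I + N$ lies in the operator-norm closure of the set of mixing operators on $X$, and hence also in the operator-norm closure of the set of hypercyclic operators on $X$. Here a bounded linear operator $T$ on $X$ is *mixing* if for each pair $U, V$ of nonempty open subsets of $X$ there is $n_0$ such that $T^n(U) \cap V \neq \emptyset$ for all $n > n_0$, and *hypercyclic* if there is a vector $v \in X$ whose orbit $\{v, Tv, T^2v, \ldots\}$ is dense in $X$. -/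

import Mathlib

/-- The hypercyclic operators on `X`: the bounded linear operators `T` for which some vector `v`
has a dense orbit `{v, T v, T² v, …}`. -/
def hypercyclicOperators (X : Type*) [NormedAddCommGroup X] [NormedSpace ℂ X] :
    Set (X →L[ℂ] X) :=
  {T | ∃ v : X, Dense (Set.range fun n : ℕ => (T ^ n) v)}

/-- The mixing operators on `X`: the bounded linear operators `T` such that for each pair `U`, `V`
of nonempty open sets, `Tⁿ(U)` meets `V` for all sufficiently large `n`. -/
def mixingOperators (X : Type*) [NormedAddCommGroup X] [NormedSpace ℂ X] :
    Set (X →L[ℂ] X) :=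
  {T | ∀ U V : Set X, IsOpen U → U.Nonempty → IsOpen V → V.Nonempty →
    ∃ n₀ : ℕ, ∀ n : ℕ, n₀ < n → ((T ^ n) '' U ∩ V).Nonempty}

/-!
By greedily adjoining vectors that `N` sends into the span of the earlier ones, one finds a flag
`0 = F₀ ⊂ F₁ ⊂ ⋯` with dense union, with `dim Fₙ = n` and `N Fₙ₊₁ ⊆ Fₙ`. A small nuclear
perturbation `L` makes every superdiagonal entry of `N + L` nonzero, so `N + L` maps `Fₙ₊₁` onto
`Fₙ` and is therefore a backward shift along a sequence `v` spanning the union, with weights of our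
choice. For weights `c (n + 1)`, letting `vₙ` correspond to the falling factorial
`X (X - 1) ⋯ (X - n + 1)` turns `c + N + L` into `c` times the translation `p(X) ↦ p(X + 1)`. The
latter is mixing: for `n` even and larger than both degrees, the polynomials
`p(X) (1 - X / m) ^ n + c ^ (-m) q(X - m) (X / m) ^ n` tend to `p`, while their images
`c ^ m p(X + m) (X / m) ^ n + q(X) (1 + X / m) ^ n` under the `m`-th iterate tend to `q`.
-/

open Bornology Filter Polynomial Set Submodule Topology

section Transitivity

/-- Birkhoff's transitivity theorem. -/
theorem exists_dense_range_of_forall_image_inter_nonempty {ι X Y : Type*} [TopologicalSpace X]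
    [BaireSpace X] [Nonempty X] [TopologicalSpace Y] [SecondCountableTopology Y] {f : ι → X → Y}
    (hf : ∀ i, Continuous (f i))
    (h : ∀ (U : Set X) (V : Set Y), IsOpen U → U.Nonempty → IsOpen V → V.Nonempty →
      ∃ i, (f i '' U ∩ V).Nonempty) :
    ∃ x, Dense (range fun i => f i x) := by
  have hB := TopologicalSpace.isBasis_countableBasis Y
  have hdense : Dense (⋂ V ∈ TopologicalSpace.countableBasis Y, ⋃ i, f i ⁻¹' V) := by
    refine dense_biInter_of_isOpen
      (fun V hV => isOpen_iUnion fun i => (hB.isOpen hV).preimage (hf i))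
      (TopologicalSpace.countable_countableBasis Y)
      fun V hV => dense_iff_inter_open.2 fun U hU hUne => ?_
    obtain ⟨i, _, ⟨x, hxU, rfl⟩, hxV⟩ := h U V hU hUne (hB.isOpen hV)
      (TopologicalSpace.nonempty_of_mem_countableBasis hV)
    exact ⟨x, hxU, mem_iUnion.2 ⟨i, hxV⟩⟩
  obtain ⟨x, hx⟩ := hdense.nonempty
  refine ⟨x, hB.dense_iff.2 fun V hV _ => ?_⟩
  obtain ⟨i, hi⟩ := mem_iUnion.1 (mem_iInter₂.1 hx V hV)
  exact ⟨f i x, hi, i, rfl⟩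

theorem mixingOperators_subset_hypercyclicOperators (E : Type*) [NormedAddCommGroup E]
    [NormedSpace ℂ E] [CompleteSpace E] [TopologicalSpace.SeparableSpace E] :
    mixingOperators E ⊆ hypercyclicOperators E := by
  intro T hT
  have := UniformSpace.secondCountable_of_separable E
  refine exists_dense_range_of_forall_image_inter_nonempty (fun n => (T ^ n).continuous)
    fun U V hU hUne hV hVne => ?_
  obtain ⟨n₀, hn₀⟩ := hT U V hU hUne hV hVne
  exact ⟨n₀ + 1, hn₀ _ n₀.lt_succ_self⟩

end Transitivity

section Translation

section Blend

variable {𝕜 : Type*} [Field 𝕜]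

/-- A polynomial that is close to `p` for large `s` and bounded `b`, if `n` exceeds the degree of
`q`, and that the translation by `-s` exchanges, up to the factor `b`, with the analogous polynomial
close to `q`; see `taylor_translationBlend`. It witnesses that translations are mixing. -/
noncomputable def translationBlend (n : ℕ) (s b : 𝕜) (p q : 𝕜[X]) : 𝕜[X] :=
  p * (1 + C s⁻¹ * X) ^ n + C b * (taylor s q * (C s⁻¹ * X) ^ n)

/-- Evenness of `n` absorbs the signs in `1 + s⁻¹ (X - s) = s⁻¹ X` and
`s⁻¹ (X - s) = -(1 + (-s)⁻¹ X)`. -/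
theorem taylor_translationBlend {n : ℕ} (hn : Even n) {s b : 𝕜} (hs : s ≠ 0) (hb : b ≠ 0)
    (p q : 𝕜[X]) :
    taylor (-s) (translationBlend n s b p q) = C b * translationBlend n (-s) b⁻¹ q p := by
  have hCs : (C s⁻¹ * C s : 𝕜[X]) = 1 := by rw [← C_mul, inv_mul_cancel₀ hs, C_1]
  have hCb : (C b * C b⁻¹ : 𝕜[X]) = 1 := by rw [← C_mul, mul_inv_cancel₀ hb, C_1]
  have h₁ : (taylor (-s) (1 + C s⁻¹ * X)) ^ n = (C (-s)⁻¹ * X) ^ n := by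
    rw [← hn.neg_pow]
    congr 1
    simp only [map_add, taylor_one, taylor_mul, taylor_C, taylor_X, C_1, C_neg, inv_neg]
    linear_combination hCs
  have h₂ : (taylor (-s) (C s⁻¹ * X)) ^ n = (1 + C (-s)⁻¹ * X) ^ n := by
    rw [← hn.neg_pow]
    congr 1
    simp only [taylor_mul, taylor_C, taylor_X, C_neg, inv_neg]
    linear_combination hCs
  rw [translationBlend, map_add, taylor_mul, taylor_pow, h₁, taylor_mul, taylor_mul, taylor_pow, h₂,
    taylor_C, taylor_taylor, neg_add_cancel, taylor_zero, translationBlend]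
  linear_combination -(taylor (-s) p * (C (-s)⁻¹ * X) ^ n) * hCb

end Blend

section Limits

variable {𝕜 E ι : Type*} [NormedField 𝕜] [AddCommGroup E] [TopologicalSpace E] [Module 𝕜 E]
  [ContinuousAdd E] [ContinuousSMul 𝕜 E] {l : Filter ι}

theorem tendsto_map_mul_one_add_C_mul_X_pow (Φ : 𝕜[X] →ₗ[𝕜] E) {a : ι → 𝕜}
    (ha : Tendsto a l (𝓝 0)) (n : ℕ) (p : 𝕜[X]) :
    Tendsto (fun m => Φ (p * (1 + C (a m) * X) ^ n)) l (𝓝 (Φ p)) := by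
  induction n generalizing p with
  | zero => simpa using tendsto_const_nhds
  | succ n ih =>
    have h := (ih p).add (ha.smul (ih (p * X)))
    rw [zero_smul, add_zero] at h
    refine h.congr fun m => ?_
    rw [← map_smul, ← map_add, smul_eq_C_mul]
    congr 1
    ring

theorem tendsto_map_taylor_monomial_mul_pow (Φ : 𝕜[X] →ₗ[𝕜] E) {s b : ι → 𝕜}
    (hs : Tendsto s l (cobounded 𝕜)) (hb : l.IsBoundedUnder (· ≤ ·) (norm ∘ b)) {i n : ℕ}
    (hi : i < n) (a : 𝕜) :
    Tendsto (fun m => Φ (C (b m) * (taylor (s m) (monomial i a) * (C (s m)⁻¹ * X) ^ n))) l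
      (𝓝 0) := by
  have hinv : Tendsto (fun m => (s m)⁻¹) l (𝓝 0) := tendsto_inv₀_cobounded.comp hs
  have hcoeff : Tendsto (fun m => a * ((s m)⁻¹ ^ (n - i) * b m)) l (𝓝 0) := by
    have hpow : Tendsto (fun m => (s m)⁻¹ ^ (n - i)) l (𝓝 0) := by
      simpa [(Nat.sub_pos_of_lt hi).ne'] using hinv.pow (n - i)
    simpa using (hpow.zero_mul_isBoundedUnder_le hb).const_mul a
  have hlim := hcoeff.smul (tendsto_map_mul_one_add_C_mul_X_pow Φ hinv i (X ^ n))
  rw [zero_smul] at hlim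
  refine hlim.congr' ?_
  filter_upwards [hs.eventually_ne_cobounded 0] with m hm
  have hX : X + C (s m) = C (s m) * (1 + C (s m)⁻¹ * X) := by
    rw [mul_add, ← mul_assoc, ← C_mul, mul_inv_cancel₀ hm, C_1]
    ring
  have hscale : (s m)⁻¹ ^ (n - i) = (s m)⁻¹ ^ n * s m ^ i := by
    rw [pow_sub₀ _ (inv_ne_zero hm) hi.le, inv_pow, inv_pow, inv_inv]
  rw [← map_smul, smul_eq_C_mul, hscale, taylor_monomial, hX]
  simp only [C_mul, C_pow, mul_pow]
  congr 1
  ring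

theorem tendsto_map_taylor_mul_pow (Φ : 𝕜[X] →ₗ[𝕜] E) {s b : ι → 𝕜}
    (hs : Tendsto s l (cobounded 𝕜)) (hb : l.IsBoundedUnder (· ≤ ·) (norm ∘ b)) {n : ℕ}
    {q : 𝕜[X]} (hq : q.natDegree < n) :
    Tendsto (fun m => Φ (C (b m) * (taylor (s m) q * (C (s m)⁻¹ * X) ^ n))) l (𝓝 0) := by
  have hsum := tendsto_finsetSum (Finset.range n) fun i hi =>
    tendsto_map_taylor_monomial_mul_pow Φ hs hb (Finset.mem_range.1 hi) (q.coeff i)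
  rw [Finset.sum_const_zero] at hsum
  refine hsum.congr fun m => ?_
  rw [← map_sum, ← Finset.mul_sum, ← Finset.sum_mul, ← map_sum, ← q.as_sum_range' n hq]

theorem tendsto_map_translationBlend (Φ : 𝕜[X] →ₗ[𝕜] E) {s b : ι → 𝕜}
    (hs : Tendsto s l (cobounded 𝕜)) (hb : l.IsBoundedUnder (· ≤ ·) (norm ∘ b)) {n : ℕ}
    (p : 𝕜[X]) {q : 𝕜[X]} (hq : q.natDegree < n) :
    Tendsto (fun m => Φ (translationBlend n (s m) (b m) p q)) l (𝓝 (Φ p)) := by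
  simpa only [translationBlend, map_add, add_zero, Function.comp_apply] using
    (tendsto_map_mul_one_add_C_mul_X_pow Φ (tendsto_inv₀_cobounded.comp hs) n p).add
      (tendsto_map_taylor_mul_pow Φ hs hb hq)

end Limits

theorem pow_apply_map_taylor {R M : Type*} [CommSemiring R] [AddCommMonoid M] [Module R M]
    {T : Module.End R M} {c : R} {Φ : R[X] →ₗ[R] M} (hT : ∀ p, T (Φ p) = c • Φ (taylor 1 p))
    (m : ℕ) (p : R[X]) : (T ^ m) (Φ p) = c ^ m • Φ (taylor (m : R) p) := by
  induction m with
  | zero => simp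
  | succ m ih =>
    rw [pow_succ', Module.End.mul_apply, ih, map_smul, hT, taylor_taylor, smul_smul, ← pow_succ,
      Nat.cast_succ, add_comm (m : R)]

theorem mem_mixingOperators_of_taylor {E : Type*} [NormedAddCommGroup E] [NormedSpace ℂ E]
    {T : E →L[ℂ] E} {c : ℂ} (hc : ‖c‖ = 1) {Φ : ℂ[X] →ₗ[ℂ] E}
    (hT : ∀ p, T (Φ p) = c • Φ (taylor 1 p)) (hΦ : DenseRange Φ) : T ∈ mixingOperators E := by
  intro U V hU hUne hV hVne
  obtain ⟨p, hp⟩ := hΦ.exists_mem_open hU hUne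
  obtain ⟨q, hq⟩ := hΦ.exists_mem_open hV hVne
  obtain ⟨n, hn, hpn, hqn⟩ : ∃ n, Even n ∧ p.natDegree < n ∧ q.natDegree < n :=
    ⟨2 * (p.natDegree + q.natDegree + 1), even_two_mul _, by lia, by lia⟩
  have hc0 : c ≠ 0 := norm_ne_zero_iff.1 (hc ▸ one_ne_zero)
  have hcast : Tendsto (fun m : ℕ => (m : ℂ)) atTop (cobounded ℂ) :=
    tendsto_natCast_atTop_cobounded
  let u : ℕ → ℂ[X] := fun m => translationBlend n (-(m : ℂ)) (c ^ m)⁻¹ p q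
  have hu : Tendsto (fun m => Φ (u m)) atTop (𝓝 (Φ p)) :=
    tendsto_map_translationBlend Φ (tendsto_neg_cobounded.comp hcast)
      (isBoundedUnder_of ⟨1, fun m => by simp [hc]⟩) p hqn
  have hTu : Tendsto (fun m => (T ^ m) (Φ (u m))) atTop (𝓝 (Φ q)) := by
    refine (tendsto_map_translationBlend Φ hcast (b := fun m => c ^ m)
      (isBoundedUnder_of ⟨1, fun m => by simp [hc]⟩) q hpn).congr' ?_
    filter_upwards [eventually_ne_atTop 0] with m hm
    have hblend : taylor (m : ℂ) (u m) = C (c ^ m)⁻¹ * translationBlend n (m : ℂ) (c ^ m) q p := by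
      simpa using taylor_translationBlend hn (neg_ne_zero.2 (Nat.cast_ne_zero.2 hm))
        (inv_ne_zero (pow_ne_zero m hc0)) p q
    have hpow : (T ^ m) (Φ (u m)) = c ^ m • Φ (taylor (m : ℂ) (u m)) := by
      rw [← pow_apply_map_taylor (T := (T : E →ₗ[ℂ] E)) hT, ← ContinuousLinearMap.toLinearMap_pow,
        ContinuousLinearMap.coe_coe]
    rw [hpow, hblend, ← smul_eq_C_mul, map_smul, smul_inv_smul₀ (pow_ne_zero m hc0)]
  obtain ⟨n₀, hn₀⟩ := eventually_atTop.1
    ((hu.eventually (hU.mem_nhds hp)).and (hTu.eventually (hV.mem_nhds hq)))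
  exact ⟨n₀, fun m hm => ⟨_, ⟨_, (hn₀ m hm.le).1, rfl⟩, (hn₀ m hm.le).2⟩⟩

end Translation

section FallingFactorials

theorem taylor_one_descPochhammer_succ {R : Type*} [CommRing R] (n : ℕ) :
    taylor 1 (descPochhammer R (n + 1)) =
      descPochhammer R (n + 1) + ((n : R) + 1) • descPochhammer R n := by
  have h := congr_arg (fun p => p.comp (X + 1)) (descPochhammer_succ_comp_X_sub_one R n)
  simp only [comp_assoc, sub_comp, smul_eq_mul, mul_comp, add_comp, natCast_comp,
    one_comp, X_comp, add_sub_cancel_right, comp_X] at h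
  rw [taylor_apply, C_1, smul_eq_C_mul, C_add, C_1, C_eq_natCast]
  linear_combination -h

/-- The falling factorials as a polynomial sequence, so that they form a basis. -/
noncomputable def descPochhammerSequence (R : Type*) [CommRing R] [IsDomain R] :
    Polynomial.Sequence R where
  elems' := descPochhammer R
  degree_eq' n := by
    rw [degree_eq_natDegree (monic_descPochhammer R n).ne_zero, descPochhammer_natDegree]

theorem exists_linearMap_taylor_of_backwardShift {R M : Type*} [CommRing R] [IsDomain R]
    [AddCommGroup M] [Module R M] {S : M →ₗ[R] M} {c : R} {v : ℕ → M} (h0 : S (v 0) = 0)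
    (hS : ∀ n, S (v (n + 1)) = (c * (n + 1)) • v n) :
    ∃ Φ : R[X] →ₗ[R] M, LinearMap.range Φ = span R (range v) ∧
      ∀ p, c • Φ p + S (Φ p) = c • Φ (taylor 1 p) := by
  let b := (descPochhammerSequence R).basis fun n =>
    (monic_descPochhammer R n).leadingCoeff.symm ▸ isUnit_one
  have hb : ∀ n, b n = descPochhammer R n := fun n => Sequence.basis_eq_self _ _ n
  let Φ : R[X] →ₗ[R] M := b.constr R v
  have hΦ : ∀ n, Φ (descPochhammer R n) = v n := fun n => by rw [← hb, b.constr_basis]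
  have hlin : c • Φ + S ∘ₗ Φ = c • Φ ∘ₗ taylor 1 := by
    refine b.ext fun n => ?_
    simp only [LinearMap.add_apply, LinearMap.smul_apply, LinearMap.comp_apply, hb]
    cases n with
    | zero => rw [hΦ, h0, add_zero, descPochhammer_zero, taylor_one, C_1, ← descPochhammer_zero, hΦ]
    | succ n =>
      rw [taylor_one_descPochhammer_succ, map_add, map_smul, hΦ, hΦ, hS, smul_add, smul_smul]
  exact ⟨Φ, b.constr_range R, LinearMap.congr_fun hlin⟩

end FallingFactorials

theorem smul_id_add_mem_mixingOperators_of_backwardShift {E : Type*} [NormedAddCommGroup E]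
    [NormedSpace ℂ E] {S : E →L[ℂ] E} {c : ℂ} (hc : ‖c‖ = 1) {v : ℕ → E} (h0 : S (v 0) = 0)
    (hS : ∀ n, S (v (n + 1)) = (c * (n + 1)) • v n)
    (hv : Dense (span ℂ (range v) : Set E)) :
    c • ContinuousLinearMap.id ℂ E + S ∈ mixingOperators E := by
  obtain ⟨Φ, hrange, hΦ⟩ := exists_linearMap_taylor_of_backwardShift (S := (S : E →ₗ[ℂ] E)) h0 hS
  refine mem_mixingOperators_of_taylor hc hΦ ?_
  rwa [DenseRange, ← LinearMap.coe_range, hrange]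

section Flags

variable {K V : Type*} [Field K] [AddCommGroup V] [Module K V]

/-- An infinite complete flag: `F 0 = 0` and `F n` is a hyperplane in `F (n + 1)`, which is encoded
by the covering relation of the lattice of subspaces. The union need not be the whole space. -/
structure IsCompleteFlag (F : ℕ → Submodule K V) : Prop where
  zero : F 0 = ⊥
  covBy : ∀ n, F n ⋖ F (n + 1)

namespace IsCompleteFlag

variable {F : ℕ → Submodule K V}

theorem monotone (hF : IsCompleteFlag F) : Monotone F :=
  monotone_nat_of_le_succ fun n => (hF.covBy n).le

theorem sup_span_singleton (hF : IsCompleteFlag F) {n : ℕ} {x : V} (hx : x ∈ F (n + 1))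
    (hx' : x ∉ F n) : F n ⊔ K ∙ x = F (n + 1) :=
  ((hF.covBy n).eq_or_eq le_sup_left
    (sup_le (hF.covBy n).le ((span_singleton_le_iff_mem x _).2 hx))).resolve_left
      fun h => hx' (h ▸ mem_sup_right (mem_span_singleton_self x))

theorem finiteDimensional (hF : IsCompleteFlag F) (n : ℕ) : FiniteDimensional K (F n) := by
  induction n with
  | zero => rw [hF.zero]; infer_instance
  | succ n ih =>
    obtain ⟨x, hx, hx'⟩ := SetLike.exists_of_lt (hF.covBy n).lt
    rw [← hF.sup_span_singleton hx hx']
    infer_instance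

theorem surjOn_of_mapsTo (hF : IsCompleteFlag F) {S : V →ₗ[K] V}
    (hS : ∀ n, MapsTo S (F (n + 1)) (F n)) (hS' : ∀ n, ∃ x ∈ F (n + 2), S x ∉ F n) (n : ℕ) :
    SurjOn S (F (n + 1)) (F n) := by
  induction n with
  | zero =>
    rintro x hx
    rw [hF.zero, bot_coe, mem_singleton_iff] at hx
    exact ⟨0, zero_mem _, by rw [map_zero, hx]⟩
  | succ n ih =>
    obtain ⟨x, hx, hSx⟩ := hS' n
    have hn : F n ≤ (F (n + 2)).map S := fun y hy => by
      obtain ⟨z, hz, rfl⟩ := ih hy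
      exact mem_map_of_mem ((hF.covBy (n + 1)).le hz)
    change F (n + 1) ≤ (F (n + 2)).map S
    rw [← hF.sup_span_singleton (hS (n + 1) hx) hSx]
    exact sup_le hn ((span_singleton_le_iff_mem _ _).2 (mem_map_of_mem hx))

theorem span_range_eq_iSup (hF : IsCompleteFlag F) {v : ℕ → V} (hv : ∀ n, v n ∈ F (n + 1))
    (hv' : ∀ n, v n ∉ F n) : span K (range v) = ⨆ n, F n := by
  refine le_antisymm (span_le.2 ?_) (iSup_le fun n => ?_)
  · rintro _ ⟨n, rfl⟩
    exact mem_iSup_of_mem (n + 1) (hv n)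
  · induction n with
    | zero => simp [hF.zero]
    | succ n ih =>
      rw [← hF.sup_span_singleton (hv n) (hv' n)]
      exact sup_le ih (span_mono (singleton_subset_iff.2 (mem_range_self n)))

theorem exists_backwardShift (hF : IsCompleteFlag F) {S : V →ₗ[K] V}
    (hS : ∀ n, MapsTo S (F (n + 1)) (F n)) (hsurj : ∀ n, SurjOn S (F (n + 1)) (F n))
    {w : ℕ → K} (hw : ∀ n, w n ≠ 0) :
    ∃ v : ℕ → V, S (v 0) = 0 ∧ (∀ n, S (v (n + 1)) = w n • v n) ∧
      span K (range v) = ⨆ n, F n := by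
  have lift : ∀ n x, x ∈ F (n + 1) ∧ x ∉ F n →
      ∃ y, (y ∈ F (n + 2) ∧ y ∉ F (n + 1)) ∧ S y = w n • x := by
    rintro n x ⟨hx, hx'⟩
    obtain ⟨y, hy, hSy⟩ := hsurj (n + 1) ((F (n + 1)).smul_mem (w n) hx)
    refine ⟨y, ⟨hy, fun hy' => hx' ?_⟩, hSy⟩
    rw [← smul_mem_iff _ (hw n), ← hSy]
    exact hS n hy'
  obtain ⟨v₀, hv₀⟩ := SetLike.exists_of_lt (hF.covBy 0).lt
  choose! next hnext hSnext using lift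
  let v : ℕ → V := fun n => Nat.rec v₀ next n
  have hv : ∀ n, v n ∈ F (n + 1) ∧ v n ∉ F n := fun n => by
    induction n with
    | zero => exact hv₀
    | succ n ih => exact hnext n _ ih
  have hSv₀ : S v₀ ∈ F 0 := hS 0 hv₀.1
  refine ⟨v, ?_, fun n => hSnext n _ (hv n),
    hF.span_range_eq_iSup (fun n => (hv n).1) fun n => (hv n).2⟩
  rwa [hF.zero, Submodule.mem_bot] at hSv₀

end IsCompleteFlag

/-- Follow the orbit of a vector outside `p` until the last time it is outside `p`. -/
theorem exists_notMem_map_mem {S : V →ₗ[K] V} {z : ℕ → V} (hz : ∀ i, S (z i) ∈ range z)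
    (hnil : ∀ i, ∃ k, (S ^ k) (z i) = 0) {p : Submodule K V} (hp : ∃ i, z i ∉ p) :
    ∃ i, z i ∉ p ∧ S (z i) ∈ p := by
  by_contra! hstay
  obtain ⟨i, hi⟩ := hp
  have horbit : ∀ k, ∃ j, z j = (S ^ k) (z i) ∧ z j ∉ p := fun k => by
    induction k with
    | zero => exact ⟨i, rfl, hi⟩
    | succ k ih =>
      obtain ⟨j, hj, hjp⟩ := ih
      obtain ⟨j', hj'⟩ := hz j
      exact ⟨j', by rw [hj', hj, pow_succ', Module.End.mul_apply], hj' ▸ hstay j hjp⟩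
  obtain ⟨k, hk⟩ := hnil i
  obtain ⟨j, hj, hjp⟩ := horbit k
  exact hjp (by rw [hj, hk]; exact p.zero_mem)

theorem exists_greedy_flag {S : V →ₗ[K] V} {z : ℕ → V} (hz : ∀ i, S (z i) ∈ range z)
    (hnil : ∀ i, ∃ k, (S ^ k) (z i) = 0) (hinf : ¬ FiniteDimensional K (span K (range z))) :
    ∃ (F : ℕ → Submodule K V) (i : ℕ → ℕ), F 0 = ⊥ ∧
      (∀ n, F (n + 1) = K ∙ z (i n) ⊔ F n) ∧
      ∀ n, IsLeast {j | z j ∉ F n ∧ S (z j) ∈ F n} (i n) := by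
  have hleast : ∀ p : Submodule K V, FiniteDimensional K p →
      ∃ i, IsLeast {j | z j ∉ p ∧ S (z j) ∈ p} i := by
    intro p _
    have hp : ∃ i, z i ∉ p := by
      by_contra! hle
      exact hinf (finiteDimensional_of_le (span_le.2 (range_subset_iff.2 hle)))
    exact ⟨_, isLeast_csInf (exists_notMem_map_mem hz hnil hp)⟩
  choose! first hfirst using hleast
  obtain ⟨F, hF0, hFsucc⟩ : ∃ F : ℕ → Submodule K V, F 0 = ⊥ ∧
      ∀ n, F (n + 1) = K ∙ z (first (F n)) ⊔ F n :=
    ⟨Nat.rec ⊥ fun _ p => K ∙ z (first p) ⊔ p, rfl, fun _ => rfl⟩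
  have hF : ∀ n, FiniteDimensional K (F n) := fun n => by
    induction n with
    | zero => exact hF0 ▸ finiteDimensional_bot K V
    | succ n _ => exact hFsucc n ▸ inferInstance
  exact ⟨F, fun n => first (F n), hF0, hFsucc, fun n => hfirst _ (hF n)⟩

theorem exists_isCompleteFlag_of_locallyNilpotent {S : V →ₗ[K] V} {z : ℕ → V}
    (hz : ∀ i, S (z i) ∈ range z) (hnil : ∀ i, ∃ k, (S ^ k) (z i) = 0)
    (hinf : ¬ FiniteDimensional K (span K (range z))) :
    ∃ F : ℕ → Submodule K V, IsCompleteFlag F ∧ (∀ n, MapsTo S (F (n + 1)) (F n)) ∧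
      range z ⊆ (⨆ n, F n : Submodule K V) := by
  obtain ⟨F, i, hF0, hFsucc, hi⟩ := exists_greedy_flag hz hnil hinf
  have hF : IsCompleteFlag F :=
    ⟨hF0, fun n => hFsucc n ▸ covBy_span_singleton_sup (hi n).1.1⟩
  have hstep : ∀ n, F n ≤ (F n).comap S → F (n + 1) ≤ (F n).comap S := fun n hn => by
    rw [hFsucc]
    exact sup_le ((span_singleton_le_iff_mem _ _).2 (hi n).1.2) hn
  have hinvariant : ∀ n, F n ≤ (F n).comap S := fun n => by
    induction n with
    | zero => simp [hF0]
    | succ n ih => exact (hstep n ih).trans (comap_mono (hF.covBy n).le)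
  refine ⟨F, hF, fun n => hstep n (hinvariant n), ?_⟩
  -- A vector never adjoined, but mapped into the union, would bound the distinct indices `i n`.
  have hinj : Function.Injective i := Function.Injective.of_lt_imp_ne fun m n hmn heq => by
    refine (hi n).1.1 (hF.monotone (Nat.succ_le_of_lt hmn) ?_)
    rw [hFsucc, ← heq]
    exact mem_sup_left (mem_span_singleton_self _)
  by_contra hsub
  obtain ⟨j, hj, hSj⟩ := exists_notMem_map_mem hz hnil
    (by simpa only [range_subset_iff, SetLike.mem_coe, not_forall] using hsub)
  obtain ⟨m, hm⟩ := (mem_iSup_of_directed F hF.monotone.directed_le).1 hSj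
  obtain ⟨n, hjn, hmn⟩ := ((hinj.nat_tendsto_atTop.eventually_gt_atTop j).and
    (eventually_ge_atTop m)).exists
  exact hjn.not_ge ((hi n).2 ⟨fun h => hj (mem_iSup_of_mem n h), hF.monotone hmn hm⟩)

end Flags

section Perturbation

variable {𝕜 E : Type*} [RCLike 𝕜] [NormedAddCommGroup E] [NormedSpace 𝕜 E]

theorem exists_dual_eq_one_of_notMem {p : Submodule 𝕜 E} (hp : IsClosed (p : Set E)) {x : E}
    (hx : x ∉ p) : ∃ f : StrongDual 𝕜 E, f x = 1 ∧ ∀ y ∈ p, f y = 0 := by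
  have hx0 : p.mkQL x ≠ 0 := by simpa using hx
  obtain ⟨f, hf⟩ := SeparatingDual.exists_eq_one (R := 𝕜) hx0
  refine ⟨f.comp p.mkQL, hf, fun y hy => ?_⟩
  simp [(Quotient.mk_eq_zero p).2 hy]

theorem exists_pos_forall_norm_tsum_smul_le [CompleteSpace E] (R : ℕ → E) {ε : ℝ} (hε : 0 < ε) :
    ∃ η : ℕ → ℝ, (∀ n, 0 < η n) ∧ ∀ w : ℕ → 𝕜, (∀ n, ‖w n‖ ≤ η n) →
      Summable (fun n => w n • R n) ∧ ‖∑' n, w n • R n‖ ≤ ε := by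
  refine ⟨fun n => ε / 2 / 2 ^ n / (‖R n‖ + 1), fun n => by positivity, fun w hw => ?_⟩
  have hbound : ∀ n, ‖w n • R n‖ ≤ ε / 2 / 2 ^ n := fun n => by
    rw [norm_smul]
    calc ‖w n‖ * ‖R n‖ ≤ ε / 2 / 2 ^ n / (‖R n‖ + 1) * (‖R n‖ + 1) := by
          gcongr
          · exact hw n
          · exact le_add_of_nonneg_right zero_le_one
      _ = ε / 2 / 2 ^ n := div_mul_cancel₀ _ (by positivity)
  exact ⟨.of_norm_bounded (summable_geometric_two' ε) hbound,
    tsum_of_norm_bounded (hasSum_geometric_two' ε) hbound⟩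

theorem exists_norm_le_add_ne_zero (a : 𝕜) {η : ℝ} (hη : 0 < η) :
    ∃ w : 𝕜, ‖w‖ ≤ η ∧ a + w ≠ 0 := by
  obtain ⟨w, hw0, hw⟩ := NormedField.exists_norm_lt 𝕜 hη
  obtain rfl | ha := eq_or_ne a 0
  · exact ⟨w, hw.le, by simpa using hw0⟩
  · exact ⟨0, by simpa using hη.le, by simpa using ha⟩

namespace IsCompleteFlag

variable {F : ℕ → Submodule 𝕜 E}

theorem exists_dual_system (hF : IsCompleteFlag F) :
    ∃ (e : ℕ → E) (f : ℕ → StrongDual 𝕜 E), (∀ n, e n ∈ F (n + 1)) ∧ (∀ n, f n (e n) = 1) ∧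
      ∀ n, ∀ x ∈ F n, f n x = 0 := by
  choose e he he' using fun n => SetLike.exists_of_lt (hF.covBy n).lt
  have hclosed : ∀ n, IsClosed (F n : Set E) := fun n =>
    have := hF.finiteDimensional n
    (F n).closed_of_finiteDimensional
  choose f hfe hf using fun n => exists_dual_eq_one_of_notMem (hclosed n) (he' n)
  exact ⟨e, f, he, hfe, hf⟩

variable {e : ℕ → E} {f : ℕ → StrongDual 𝕜 E} {w : ℕ → 𝕜}

theorem mapsTo_tsum_smulRight (hF : IsCompleteFlag F) (he : ∀ n, e n ∈ F (n + 1))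
    (hf : ∀ n, ∀ x ∈ F n, f n x = 0)
    (hsum : Summable fun n => w n • (f (n + 1)).smulRight (e n)) (n : ℕ) :
    MapsTo (∑' m, w m • (f (m + 1)).smulRight (e m) : E →L[𝕜] E) (F (n + 1)) (F n) := by
  intro x hx
  have := hF.finiteDimensional n
  have hx_sum := hsum.hasSum.mapL (ContinuousLinearMap.apply 𝕜 E x)
  rw [SetLike.mem_coe, ← ContinuousLinearMap.apply_apply x, ← hx_sum.tsum_eq]
  refine tsum_mem (F n).closed_of_finiteDimensional fun m => ?_
  obtain hmn | hnm := lt_or_ge m n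
  · exact (F n).smul_mem _ ((F n).smul_mem _ (hF.monotone hmn (he m)))
  · simp [hf (m + 1) x (hF.monotone (Nat.succ_le_succ hnm) hx)]

theorem dual_tsum_smulRight_apply (hF : IsCompleteFlag F) (he : ∀ n, e n ∈ F (n + 1))
    (hfe : ∀ n, f n (e n) = 1) (hf : ∀ n, ∀ x ∈ F n, f n x = 0)
    (hsum : Summable fun n => w n • (f (n + 1)).smulRight (e n)) (n : ℕ) :
    f n ((∑' m, w m • (f (m + 1)).smulRight (e m)) (e (n + 1))) = w n := by
  have hzero : ∀ {m k}, m < k → f k (e m) = 0 := fun {m k} hmk =>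
    hf k _ (hF.monotone hmk (he m))
  have hlim := hsum.hasSum.mapL ((f n).comp (ContinuousLinearMap.apply 𝕜 E (e (n + 1))))
  refine hlim.unique ?_
  convert hasSum_single n fun m hm => ?_ using 1
  · simp [hfe]
  · obtain hmn | hnm := hm.lt_or_gt
    · simp [hzero hmn]
    · simp [hzero (Nat.succ_lt_succ hnm)]

theorem exists_norm_le_surjOn_add [CompleteSpace E] (hF : IsCompleteFlag F) {N : E →L[𝕜] E}
    (hN : ∀ n, MapsTo N (F (n + 1)) (F n)) {ε : ℝ} (hε : 0 < ε) :
    ∃ L : E →L[𝕜] E, ‖L‖ ≤ ε ∧ (∀ n, MapsTo (N + L) (F (n + 1)) (F n)) ∧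
      ∀ n, SurjOn (N + L) (F (n + 1)) (F n) := by
  obtain ⟨e, f, he, hfe, hf⟩ := hF.exists_dual_system
  obtain ⟨η, hη, hsmall⟩ := exists_pos_forall_norm_tsum_smul_le (𝕜 := 𝕜)
    (fun n => (f (n + 1)).smulRight (e n)) hε
  choose w hwη hw using fun n => exists_norm_le_add_ne_zero (f n (N (e (n + 1)))) (hη n)
  obtain ⟨hsum, hnorm⟩ := hsmall w hwη
  let L := ∑' n, w n • (f (n + 1)).smulRight (e n)
  have hmaps : ∀ n, MapsTo (N + L) (F (n + 1)) (F n) := fun n x hx =>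
    add_mem (hN n hx) (hF.mapsTo_tsum_smulRight he hf hsum n hx)
  refine ⟨L, hnorm, hmaps, hF.surjOn_of_mapsTo (S := (N + L : E →ₗ[𝕜] E)) hmaps fun n => ?_⟩
  refine ⟨e (n + 1), he (n + 1), fun hmem => hw n ?_⟩
  rw [← hF.dual_tsum_smulRight_apply he hfe hf hsum n, ← map_add]
  exact hf n _ hmem

end IsCompleteFlag

theorem not_finiteDimensional_of_dense {p : Submodule 𝕜 E} (hp : Dense (p : Set E))
    (hE : ¬ FiniteDimensional 𝕜 E) : ¬ FiniteDimensional 𝕜 p := by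
  intro _
  have htop : p = ⊤ := SetLike.coe_injective <| by
    rw [← p.closed_of_finiteDimensional.closure_eq, hp.closure_eq, top_coe]
  subst htop
  exact hE (topEquiv (R := 𝕜) (M := E)).finiteDimensional

theorem exists_isCompleteFlag_of_dense_generalizedKernel [TopologicalSpace.SeparableSpace E]
    (hE : ¬ FiniteDimensional 𝕜 E) {N : E →L[𝕜] E} (hN : Dense {x | ∃ k : ℕ, (N ^ k) x = 0}) :
    ∃ F : ℕ → Submodule 𝕜 E, IsCompleteFlag F ∧ (∀ n, MapsTo N (F (n + 1)) (F n)) ∧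
      Dense ((⨆ n, F n : Submodule 𝕜 E) : Set E) := by
  have := UniformSpace.secondCountable_of_separable E
  have : Nonempty {x : E | ∃ k : ℕ, (N ^ k) x = 0} := ⟨0, 0, map_zero _⟩
  let y := TopologicalSpace.denseSeq {x : E | ∃ k : ℕ, (N ^ k) x = 0}
  have hy : DenseRange fun j => (y j : E) :=
    hN.denseRange_val.comp (TopologicalSpace.denseRange_denseSeq _) continuous_subtype_val
  let z : ℕ → E := fun i => (N ^ i.unpair.1) (y i.unpair.2)
  have hzpair : ∀ k j, z (Nat.pair k j) = (N ^ k) (y j) := fun k j => by simp [z]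
  have hz : ∀ i, N (z i) ∈ range z := fun i =>
    ⟨Nat.pair (i.unpair.1 + 1) i.unpair.2, by rw [hzpair, pow_succ']; rfl⟩
  have hnil : ∀ i, ∃ k, ((N : E →ₗ[𝕜] E) ^ k) (z i) = 0 := fun i => by
    obtain ⟨k, hk⟩ := (y i.unpair.2).2
    refine ⟨k, ?_⟩
    rw [← ContinuousLinearMap.toLinearMap_pow, ContinuousLinearMap.coe_coe]
    change (N ^ k * N ^ i.unpair.1) (y i.unpair.2) = 0
    rw [← pow_add, add_comm, pow_add, mul_apply_eq_comp, hk, map_zero]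
  have hzdense : Dense (range z) :=
    hy.mono (range_subset_iff.2 fun j => ⟨Nat.pair 0 j, hzpair 0 j⟩)
  obtain ⟨F, hF, hmaps, hsub⟩ := exists_isCompleteFlag_of_locallyNilpotent
    (S := (N : E →ₗ[𝕜] E)) hz hnil (not_finiteDimensional_of_dense (hzdense.mono subset_span) hE)
  exact ⟨F, hF, hmaps, hzdense.mono hsub⟩

end Perturbation

theorem corollary3p2_general {X : Type*} [NormedAddCommGroup X] [NormedSpace ℂ X]
    [CompleteSpace X] [TopologicalSpace.SeparableSpace X] (hX : ¬ FiniteDimensional ℂ X)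
    (N : X →L[ℂ] X) (hN : Dense {x | ∃ k : ℕ, (N ^ k) x = 0}) (c : ℂ) (hc : ‖c‖ = 1) :
    c • ContinuousLinearMap.id ℂ X + N ∈ closure (mixingOperators X) ∧
      c • ContinuousLinearMap.id ℂ X + N ∈ closure (hypercyclicOperators X) := by
  suffices h : c • ContinuousLinearMap.id ℂ X + N ∈ closure (mixingOperators X) from
    ⟨h, closure_mono (mixingOperators_subset_hypercyclicOperators X) h⟩
  have hc0 : c ≠ 0 := norm_ne_zero_iff.1 (hc ▸ one_ne_zero)
  obtain ⟨F, hF, hNF, hdense⟩ := exists_isCompleteFlag_of_dense_generalizedKernel hX hN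
  refine Metric.mem_closure_iff.2 fun ε hε => ?_
  obtain ⟨L, hL, hmaps, hsurj⟩ := hF.exists_norm_le_surjOn_add hNF (half_pos hε)
  obtain ⟨v, hv0, hv, hspan⟩ := hF.exists_backwardShift (S := (N + L : X →ₗ[ℂ] X)) hmaps hsurj
    (w := fun n => c * (n + 1)) fun n => mul_ne_zero hc0 n.cast_add_one_ne_zero
  refine ⟨c • ContinuousLinearMap.id ℂ X + (N + L),
    smul_id_add_mem_mixingOperators_of_backwardShift hc hv0 hv (hspan ▸ hdense), ?_⟩
  rw [dist_eq_norm, ← add_assoc, sub_add_cancel_left, norm_neg]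
  exact hL.trans_lt (half_lt_self hε)

theorem corollary3p2 {X : Type*} [NormedAddCommGroup X] [NormedSpace ℂ X] [CompleteSpace X]
    [TopologicalSpace.SeparableSpace X] (hX : ¬ FiniteDimensional ℂ X)
    (N : X →L[ℂ] X) (hN : IsNilpotent N) (c : ℂ) (hc : ‖c‖ = 1) :
    c • ContinuousLinearMap.id ℂ X + N ∈ closure (mixingOperators X) ∧
      c • ContinuousLinearMap.id ℂ X + N ∈ closure (hypercyclicOperators X) := by
  obtain ⟨k, hk⟩ := hN
  exact corollary3p2_general hX N (fun x => subset_closure ⟨k, by simp [hk]⟩) c hc
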